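/- **Proposition 2 (Folk Theorem With Player-specific Punishments).** *Stage game with intervention.* There are $N$ users, $\mathcal N=\{1,\dots,N\}$. User $i$ has an action set $A_i$, and an intervention device (which is not a strategic player) has an action set $A_0$; these are arbitrary sets, for instance subsets of Euclidean spaces. Write $\mathcal A=\prod_{i}A_i$. User $i$ has a bounded payoff function $u_i:A_0\times\mathcal A\to\mathbb R$, and $\mathbf u=(u_1,\dots,u_N)$. There is a null intervention action $\underline a_0\in A_0$ with $u_i(a_0,\mathbf a)\le u_i(\underline a_0,\mathbf a)$ for all $i$, $a_0\in A_0$, $\mathbf a\in\mathcal A$. The pure-action minmax payoff of user $i$ with intervention is $$\underline v_i^w=\inf_{(a_0,\mathbf a_{-i})\in A_0\times\prod_{j\ne i}A_j}\ \sup_{a_i\in A_i}u_i(a_0,a_i,\mathbf a_{-i})$$ (a $\min\max$ whenever these are attained). The set of feasible payoffs is $\mathscr V_w^{\dag}=\mathrm{co}\{\mathbf u(a_0,\mathbf a):(a_0,\mathbf a)\in A_0\times\mathcal A\}$, and the set of feasible and strictly individually rational payoffs is $\mathscr V_w^{\dag p}=\{\mathbf v\in\mathscr V_w^{\dag}: v_i>\underline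 v_i^w\ \forall i\in\mathcal N\}$. *Repeated game with intervention.* The stage game is played in periods $t=0,1,2,\dots$ with perfect monitoring. Let $\mathscr H$ be the set of all finite sequences (histories) in $A_0\times\mathcal A$, including the empty one. An intervention rule is a map $\sigma_0:\mathscr H\to A_0$, and a (pure) strategy of user $i$ is a map $\sigma_i:\mathscr H\to A_i$. With discount factor $\delta\in[0,1)$, user $i$'s payoff is $U_i(\sigma_0,\sigma)=(1-\delta)\sum_{t=0}^\infty\delta^t u_i(a_0^t,\mathbf a^t)$, where $(a_0^t,\mathbf a^t)$ are the actions in period $t$ induced by $(\sigma_0,\sigma)$. For $h\in\mathscr H$ let $\sigma_0|_h$, $\sigma_i|_h$ denote the continuations $h'\mapsto\sigma_0(hh')$, $h'\mapsto\sigma_i(hh')$. The pair $(\sigma_0,\sigma)$ is a subgame perfect equilibrium if $U_i(\sigma_0|_h,\sigma|_h)\ge U_i(\sigma_0|_h,\sigma_i'|_h,\sigma_{-i}|_h)$ for all $h\in\mathscr H$, all $i\in\mathcal N$ and all strategies $\sigma_i'$ of user $i$; its payoff is $(U_1(\sigma_0,\sigma),\dots,U_N(\sigma_0,\sigma))$.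 *Claim.* Suppose that $\mathbf v\in\mathscr V_w^{\dag p}$ allows player-specific punishments, i.e. there are payoff profiles $\mathbf v^1,\dots,\mathbf v^N\in\mathscr V_w^{\dag p}$ such that for all $i\in\mathcal N$, $v_i>v_i^i$, and $v_i^j>v_i^i$ for all $j\ne i$. Then there exists $\underline\delta\in[0,1)$ such that for every $\delta\in(\underline\delta,1)$ the repeated game with intervention and discount factor $\delta$ has a subgame perfect equilibrium with payoff $\mathbf v$. -/

import Mathlib

/-- A stage game with intervention among the users `Fin N`. `A i` is the (pure) action set of
user `i`, `A₀` is the action set of the intervention device, and `u i a₀ a` is the payoff of user `i`.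
There is a null intervention action, and intervening can only decrease the users' payoffs.
The action sets are arbitrary types; subsets of Euclidean spaces are a special case. -/
structure InterventionGame (N : ℕ) where
  /-- the action set of the intervention device -/
  A₀ : Type*
  /-- the action sets of the users -/
  A : Fin N → Type*
  /-- the stage-game payoffs -/
  u : Fin N → A₀ → (∀ i, A i) → ℝ
  /-- the null intervention action -/
  null : A₀
  /-- intervention can only decrease payoffs -/
  u_le_null : ∀ i a₀ a, u i a₀ a ≤ u i null a

namespace InterventionGame

variable {N : ℕ} (G : InterventionGame N)

/-- Action profiles of the users. -/
abbrev Profile := ∀ i, G.A i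

/-- All stage-game payoff functions are bounded. -/
def BoundedPayoffs : Prop :=
  ∀ i, ∃ C : ℝ, ∀ (a₀ : G.A₀) (a : G.Profile), |G.u i a₀ a| ≤ C

/-- The pure-action minmax payoff with intervention of user `i`. The `i`-th entry of the profile
`p.2` is overwritten, so that the infimum is over `a₀` and the actions of the users other
than `i`. -/
noncomputable def minmax (i : Fin N) : ℝ :=
  ⨅ p : G.A₀ × G.Profile, ⨆ b : G.A i, G.u i p.1 (Function.update p.2 i b)

/-- Feasible payoffs: the convex hull of the stage-game payoff vectors. -/
def feasible : Set (Fin N → ℝ) :=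
  convexHull ℝ {v | ∃ (a₀ : G.A₀) (a : G.Profile), v = fun i => G.u i a₀ a}

/-- Feasible and strictly individually rational payoffs. -/
def feasibleIR : Set (Fin N → ℝ) :=
  {v | v ∈ G.feasible ∧ ∀ i, G.minmax i < v i}

/-- The family `p` (where `p i` is the payoff vector used to punish user `i`) is a
player-specific punishment for `v`. -/
def IsPlayerSpecificPunishment (v : Fin N → ℝ) (p : Fin N → Fin N → ℝ) : Prop :=
  (∀ i, p i ∈ G.feasibleIR) ∧ (∀ i, p i i < v i) ∧ ∀ i j, j ≠ i → p i i < p j i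

/-- `v` allows player-specific punishments. -/
def AllowsPlayerSpecificPunishments (v : Fin N → ℝ) : Prop :=
  ∃ p : Fin N → Fin N → ℝ, G.IsPlayerSpecificPunishment v p

/-- Finite histories of play, the earliest period first; the empty list is the initial history. -/
abbrev History := List (G.A₀ × G.Profile)

/-- Intervention rules. -/
abbrev Rule := G.History → G.A₀

/-- Joint (pure) strategies of the users. -/
abbrev Strategy := ∀ i, G.History → G.A i

variable {G}

/-- The action profile played at history `h`. -/
def play (σ₀ : G.Rule) (σ : G.Strategy) (h : G.History) : G.A₀ × G.Profile :=
  (σ₀ h, fun i => σ i h)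

/-- The history at period `t` induced by `(σ₀, σ)`. -/
def inducedHistory (σ₀ : G.Rule) (σ : G.Strategy) : ℕ → G.History
  | 0 => []
  | t + 1 => inducedHistory σ₀ σ t ++ [play σ₀ σ (inducedHistory σ₀ σ t)]

/-- The action profile of period `t` induced by `(σ₀, σ)`. -/
def outcome (σ₀ : G.Rule) (σ : G.Strategy) (t : ℕ) : G.A₀ × G.Profile :=
  play σ₀ σ (inducedHistory σ₀ σ t)

/-- The normalized discounted payoff of user `i` in the repeated game with discount factor `δ`. -/
noncomputable def payoff (δ : ℝ) (σ₀ : G.Rule) (σ : G.Strategy) (i : Fin N) : ℝ :=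
  (1 - δ) * ∑' t : ℕ, δ ^ t * G.u i (outcome σ₀ σ t).1 (outcome σ₀ σ t).2

/-- The continuation intervention rule after history `h`. -/
def Rule.after (σ₀ : G.Rule) (h : G.History) : G.Rule := fun h' => σ₀ (h ++ h')

/-- The continuation joint strategy after history `h`. -/
def Strategy.after (σ : G.Strategy) (h : G.History) : G.Strategy := fun i h' => σ i (h ++ h')

/-- `(σ₀, σ)` is a subgame perfect equilibrium of the repeated game with discount factor `δ`:
after no history can a user gain by a unilateral change of strategy. The intervention device is
not strategic. -/
def IsSubgamePerfect (δ : ℝ) (σ₀ : G.Rule) (σ : G.Strategy) : Prop :=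
  ∀ (h : G.History) (i : Fin N) (τ : G.History → G.A i),
    payoff δ (Rule.after σ₀ h) (Strategy.after (Function.update σ i τ) h) i ≤
      payoff δ (Rule.after σ₀ h) (Strategy.after σ h) i

end InterventionGame

/-! Play follows a path worth `v`. A unilateral deviation by user `i`, from any path, starts the
punishment of `i`: `T` periods of a profile `m i` that holds `i` to at most `w i < p i i` whatever
`i` plays, then a path worth `p i`. By `isSubgamePerfect_simple` only one-shot deviations need
checking.

Since no randomization is available, `eventually_exists_path` realizes feasible payoffs by
deterministic paths whose continuation values never fall far below the target. The punishment is
worth at most `p i i - κ * c` to `i`, which for patient users outweighs any one-period gain.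

The length `T` satisfies `1 - 2κ ≤ δ ^ T ≤ 1 - κ`: long enough to hurt `i`, short enough that the
others endure it for the sake of the later reward `p i j > p j j`. The minmax need not be attained,
so the action of `i` in `m i` need not be a best reply; `i` conforms because deviating delays the
return to `p i`. -/

open Filter Topology

/-! ### Discounted values and their recursion. -/

/-- The normalized discounted value, from period `t` on, of the stream `x`. -/
noncomputable def discountedValue (δ : ℝ) (x : ℕ → ℝ) (t : ℕ) : ℝ :=
  (1 - δ) * ∑' n : ℕ, δ ^ n * x (t + n)

section Discounting

variable {δ C : ℝ} {x : ℕ → ℝ}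

lemma summable_discounted (h0 : 0 ≤ δ) (h1 : δ < 1) (hx : ∀ t, |x t| ≤ C) :
    Summable fun n : ℕ => δ ^ n * x n := by
  refine Summable.of_norm_bounded (g := fun n : ℕ => δ ^ n * C)
    ((summable_geometric_of_lt_one h0 h1).mul_right C) fun n => ?_
  rw [Real.norm_eq_abs, abs_mul, abs_of_nonneg (pow_nonneg h0 n)]
  exact mul_le_mul_of_nonneg_left (hx n) (pow_nonneg h0 n)

lemma discountedValue_succ (h0 : 0 ≤ δ) (h1 : δ < 1) (hx : ∀ t, |x t| ≤ C) (t : ℕ) :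
    discountedValue δ x t = (1 - δ) * x t + δ * discountedValue δ x (t + 1) := by
  have hs : Summable fun n : ℕ => δ ^ n * x (t + n) :=
    summable_discounted h0 h1 fun n => hx (t + n)
  have htail : ∑' n : ℕ, δ ^ (n + 1) * x (t + (n + 1)) = δ * ∑' n : ℕ, δ ^ n * x (t + 1 + n) := by
    rw [← tsum_mul_left]
    refine tsum_congr fun n => ?_
    rw [show t + (n + 1) = t + 1 + n by omega]
    ring
  unfold discountedValue
  rw [hs.tsum_eq_zero_add, htail]
  simp only [pow_zero, add_zero, one_mul]
  ring

/-- A bounded process that is at least as large as the current payoff plus its own discounted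
future value dominates the discounted value of the payoff stream. -/
lemma discountedValue_le_of_step (h0 : 0 ≤ δ) (h1 : δ < 1) (hx : ∀ t, |x t| ≤ C)
    {W : ℕ → ℝ} {D : ℝ} (hW : ∀ t, |W t| ≤ D)
    (hstep : ∀ t, (1 - δ) * x t + δ * W (t + 1) ≤ W t) (t : ℕ) :
    discountedValue δ x t ≤ W t := by
  have hs : Summable fun n : ℕ => δ ^ n * x (t + n) :=
    summable_discounted h0 h1 fun n => hx (t + n)
  have hpart : ∀ n : ℕ, (1 - δ) * ∑ k ∈ Finset.range n, δ ^ k * x (t + k) + δ ^ n * W (t + n)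
      ≤ W t := by
    intro n
    induction n with
    | zero => simp
    | succ n ih =>
      have h := mul_le_mul_of_nonneg_left (hstep (t + n)) (pow_nonneg h0 n)
      rw [Finset.sum_range_succ, pow_succ, show t + (n + 1) = t + n + 1 by omega]
      linarith
  have hzero : Tendsto (fun n : ℕ => δ ^ n * W (t + n)) atTop (𝓝 0) :=
    (summable_discounted h0 h1 fun n => hW (t + n)).tendsto_atTop_zero
  have hlim := (hs.hasSum.tendsto_sum_nat.const_mul (1 - δ)).add hzero
  rw [add_zero] at hlim
  exact le_of_tendsto' hlim hpart

lemma discountedValue_neg (t : ℕ) :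
    discountedValue δ (fun n => -x n) t = -discountedValue δ x t := by
  simp [discountedValue, tsum_neg]

lemma le_discountedValue_of_step (h0 : 0 ≤ δ) (h1 : δ < 1) (hx : ∀ t, |x t| ≤ C)
    {W : ℕ → ℝ} {D : ℝ} (hW : ∀ t, |W t| ≤ D)
    (hstep : ∀ t, W t ≤ (1 - δ) * x t + δ * W (t + 1)) (t : ℕ) :
    W t ≤ discountedValue δ x t := by
  have h := discountedValue_le_of_step (x := fun n => -x n) (W := fun n => -W n) h0 h1
    (by simpa using hx) (by simpa using hW) (fun n => by linarith [hstep n]) t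
  rw [discountedValue_neg] at h
  linarith

lemma discountedValue_eq_of_step (h0 : 0 ≤ δ) (h1 : δ < 1) (hx : ∀ t, |x t| ≤ C)
    {W : ℕ → ℝ} {D : ℝ} (hW : ∀ t, |W t| ≤ D)
    (hstep : ∀ t, W t = (1 - δ) * x t + δ * W (t + 1)) (t : ℕ) :
    discountedValue δ x t = W t :=
  le_antisymm (discountedValue_le_of_step h0 h1 hx hW (fun n => (hstep n).ge) t)
    (le_discountedValue_of_step h0 h1 hx hW (fun n => (hstep n).le) t)

lemma abs_discountedValue_le (h0 : 0 ≤ δ) (h1 : δ < 1) (hx : ∀ t, |x t| ≤ C) (t : ℕ) :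
    |discountedValue δ x t| ≤ C := by
  have hC : 0 ≤ C := (abs_nonneg _).trans (hx 0)
  have hδ : 0 ≤ 1 - δ := by linarith
  have hb := fun n => abs_le.1 (hx n)
  refine abs_le.2 ⟨?_, ?_⟩
  · exact le_discountedValue_of_step (W := fun _ => -C) (D := C) h0 h1 hx
      (fun _ => by rw [abs_neg, abs_of_nonneg hC])
      (fun n => by nlinarith [mul_le_mul_of_nonneg_left (hb n).1 hδ]) t
  · exact discountedValue_le_of_step (W := fun _ => C) (D := C) h0 h1 hx
      (fun _ => by rw [abs_of_nonneg hC])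
      (fun n => by nlinarith [mul_le_mul_of_nonneg_left (hb n).2 hδ]) t

end Discounting

/-! ### Convex combinations as discounted frequencies. -/

section ConvexCombination

variable {ι : Type*} [Fintype ι]

/-- One step of generating a convex combination by a pure stream: weights near `l` are split into
the pure choice of the current period and continuation weights near `l`. -/
lemma exists_pure_step {δ r : ℝ} {l μ : ι → ℝ} (h0 : 0 < δ) (h1 : δ < 1) (hr : ∀ j, r ≤ l j)
    (hδr : 1 - δ ≤ δ * r) (hl : ∑ j, l j = 1) (hl0 : ∀ j, 0 ≤ l j)
    (hμ : ∀ j, l j - r ≤ μ j) (hμ1 : ∑ j, μ j = 1) :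
    ∃ (k : ι) (μ' : ι → ℝ), (∀ j, l j - r ≤ μ' j) ∧ ∑ j, μ' j = 1 ∧
      ∀ z : ι → ℝ, ∑ j, μ j * z j = (1 - δ) * z k + δ * ∑ j, μ' j * z j := by
  classical
  have hne : (Finset.univ : Finset ι).Nonempty := by
    by_contra h
    rw [Finset.not_nonempty_iff_eq_empty] at h
    simp [h] at hl
  -- Both weight vectors sum to one, so some weight is at least its target; that index can afford to
  -- lose `1 - δ`.
  obtain ⟨k, -, hk⟩ := Finset.exists_le_of_sum_le hne (hl.trans hμ1.symm).le
  have key : ∀ z : ι → ℝ, ∑ j, ((μ j - if j = k then 1 - δ else 0) / δ) * z j =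
      (∑ j, μ j * z j - (1 - δ) * z k) / δ := by
    intro z
    have h : ∀ j, ((μ j - if j = k then 1 - δ else 0) / δ) * z j =
        (μ j * z j - if j = k then (1 - δ) * z j else 0) / δ := by
      intro j
      split_ifs <;> ring
    simp_rw [h]
    rw [← Finset.sum_div, Finset.sum_sub_distrib]
    simp
  refine ⟨k, fun j => (μ j - if j = k then 1 - δ else 0) / δ, fun j => ?_, ?_, fun z => ?_⟩
  · rw [le_div_iff₀ h0]
    split_ifs with hj
    · subst hj
      nlinarith [hl0 j]
    · nlinarith [hμ j, hr j]
  · have h := key fun _ => 1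
    simp only [mul_one, hμ1] at h
    rw [h, sub_sub_cancel, div_self h0.ne']
  · rw [key, mul_div_cancel₀ _ h0.ne']
    ring

/-- For a patient discounter, a convex combination with positive weights is the discounted
frequency of a pure stream all of whose continuation frequencies are close to it from below. -/
lemma exists_pure_stream {δ r : ℝ} {l : ι → ℝ} (h0 : 0 < δ) (h1 : δ < 1) (hr0 : 0 ≤ r)
    (hr : ∀ j, r ≤ l j) (hδr : 1 - δ ≤ δ * r) (hl : ∑ j, l j = 1) :
    ∃ (k : ℕ → ι) (μ : ℕ → ι → ℝ), μ 0 = l ∧ (∀ t j, l j - r ≤ μ t j) ∧ (∀ t, ∑ j, μ t j = 1) ∧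
      ∀ t, ∀ z : ι → ℝ,
        ∑ j, μ t j * z j = (1 - δ) * z (k t) + δ * ∑ j, μ (t + 1) j * z j := by
  let S := {μ : ι → ℝ // (∀ j, l j - r ≤ μ j) ∧ ∑ j, μ j = 1}
  have hex : ∀ μ : S, ∃ (k : ι) (μ' : S),
      ∀ z : ι → ℝ, ∑ j, μ.1 j * z j = (1 - δ) * z k + δ * ∑ j, μ'.1 j * z j := by
    rintro ⟨μ, hμ, hμ1⟩
    obtain ⟨k, μ', h, h', h''⟩ :=
      exists_pure_step h0 h1 hr hδr hl (fun j => hr0.trans (hr j)) hμ hμ1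
    exact ⟨k, ⟨μ', h, h'⟩, h''⟩
  choose k next hnext using hex
  let m : ℕ → S := fun t => next^[t] ⟨l, fun j => by linarith, hl⟩
  have hm : ∀ t, m (t + 1) = next (m t) := fun t => Function.iterate_succ_apply' _ _ _
  refine ⟨fun t => k (m t), fun t => (m t).1, rfl, fun t => (m t).2.1, fun t => (m t).2.2,
    fun t z => ?_⟩
  simp only [hm]
  exact hnext (m t) z

end ConvexCombination

lemma eventually_nhdsLT_one_pos : ∀ᶠ δ : ℝ in 𝓝[<] 1, 0 < δ ∧ δ < 1 :=
  Ioo_mem_nhdsLT one_pos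

lemma eventually_one_sub_le {ε : ℝ} (hε : 0 < ε) : ∀ᶠ δ : ℝ in 𝓝[<] 1, 1 - δ ≤ ε := by
  filter_upwards [Ioo_mem_nhdsLT (show 1 - ε < 1 by linarith)] with δ hδ
  linarith [hδ.1]

/-- A discount factor close to one has a power in a given window just below one. -/
lemma exists_pow_mem_window {δ κ : ℝ} (hδ1 : δ < 1) (hκ : 0 < κ) (hκ1 : κ < 1)
    (hδ : 1 - δ ≤ κ) : ∃ T : ℕ, δ ^ T ≤ 1 - κ ∧ 1 - 2 * κ ≤ δ ^ T := by
  obtain ⟨n, hn, hn'⟩ := exists_nat_pow_near_of_lt_one (x := 1 - κ) (y := δ) (by linarith)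
    (by linarith) (by linarith) hδ1
  -- The lower bound is `δ * δ ^ n ≥ (1 - κ)² ≥ 1 - 2κ`.
  refine ⟨n + 1, hn.le, ?_⟩
  rw [pow_succ]
  nlinarith [mul_le_mul_of_nonneg_right hn' (show 0 ≤ δ by linarith), sq_nonneg κ]

lemma exists_pos_forall_le {ι : Type*} [Finite ι] {f : ι → ℝ} (hf : ∀ i, 0 < f i) :
    ∃ c, 0 < c ∧ ∀ i, c ≤ f i := by
  have h : ∀ᶠ c : ℝ in 𝓝[>] 0, 0 < c ∧ ∀ i, c ≤ f i :=
    eventually_mem_nhdsWithin.and (eventually_all.2 fun i =>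
      mem_of_superset (Ioo_mem_nhdsGT (hf i)) fun _ hc => hc.2.le)
  exact h.exists

namespace InterventionGame

variable {N : ℕ} {G : InterventionGame N}

lemma BoundedPayoffs.exists_uniform_bound (h : G.BoundedPayoffs) :
    ∃ C : ℝ, 0 < C ∧ ∀ i a₀ a, |G.u i a₀ a| ≤ C := by
  choose C hC using h
  refine ⟨∑ i, |C i| + 1, by positivity, fun i a₀ a => (hC i a₀ a).trans ?_⟩
  have := Finset.single_le_sum (f := fun i => |C i|) (fun i _ => abs_nonneg _) (Finset.mem_univ i)
  linarith [le_abs_self (C i)]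

/-- The value for user `i`, from period `t` on, of the path of play `s`. -/
noncomputable def pathValue (δ : ℝ) (s : ℕ → G.A₀ × G.Profile) (i : Fin N) (t : ℕ) : ℝ :=
  discountedValue δ (fun n => G.u i (s n).1 (s n).2) t

/-- A feasible payoff vector is, for discount factors close to one, the value of a path of play
along which the continuation values never fall much below it. -/
lemma eventually_exists_path {C : ℝ} (hC : ∀ i a₀ a, |G.u i a₀ a| ≤ C) {v : Fin N → ℝ}
    (hv : v ∈ G.feasible) {ε : ℝ} (hε : 0 < ε) :
    ∀ᶠ δ : ℝ in 𝓝[<] 1, ∃ s : ℕ → G.A₀ × G.Profile,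
      (∀ i, pathValue δ s i 0 = v i) ∧ ∀ i t, v i - ε ≤ pathValue δ s i t := by
  -- Strictly positive weights leave room for a common slack `r` below all of them.
  obtain ⟨ι, _, z, l, hz, -, hl0, hl1, hlv⟩ := eq_pos_convex_span_of_mem_convexHull hv
  have hz' : ∀ k, ∃ x : G.A₀ × G.Profile, z k = fun i => G.u i x.1 x.2 := by
    intro k
    obtain ⟨a₀, a, h⟩ := hz ⟨k, rfl⟩
    exact ⟨(a₀, a), h⟩
  choose x hx using hz'
  have hv_eq : ∀ i, v i = ∑ j, l j * G.u i (x j).1 (x j).2 := by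
    intro i
    rw [← hlv, Finset.sum_apply]
    simp [hx]
  obtain ⟨c, hc, hcl⟩ := exists_pos_forall_le hl0
  obtain ⟨r, hr, hrc, hrε⟩ : ∃ r : ℝ, 0 < r ∧ r ≤ c ∧ r * (Fintype.card ι * (2 * C)) ≤ ε := by
    have h1 : Tendsto (fun r : ℝ => r * (Fintype.card ι * (2 * C))) (𝓝[>] 0) (𝓝 0) := by
      have : Tendsto (fun r : ℝ => r * (Fintype.card ι * (2 * C))) (𝓝 0) (𝓝 (0 * _)) :=
        tendsto_id.mul_const _
      rw [zero_mul] at this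
      exact this.mono_left nhdsWithin_le_nhds
    have h2 : ∀ᶠ r : ℝ in 𝓝[>] 0, 0 < r ∧ r ≤ c :=
      mem_of_superset (Ioo_mem_nhdsGT hc) fun _ h => ⟨h.1, h.2.le⟩
    obtain ⟨r, h, h'⟩ := (h2.and (h1.eventually (ge_mem_nhds hε))).exists
    exact ⟨r, h.1, h.2, h'⟩
  filter_upwards [eventually_nhdsLT_one_pos, eventually_one_sub_le (half_pos hr),
    eventually_one_sub_le (half_pos one_pos)] with δ hδ hδr hδ2
  obtain ⟨k, μ, hμ0, hμ, hμ1, hstep⟩ := exists_pure_stream hδ.1 hδ.2 hr.le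
    (fun j => hrc.trans (hcl j)) (by nlinarith) hl1
  have hμnn : ∀ t j, 0 ≤ μ t j := fun t j => by linarith [hμ t j, hcl j]
  have hbound : ∀ i t, |∑ j, μ t j * G.u i (x j).1 (x j).2| ≤ C := by
    intro i t
    calc |∑ j, μ t j * G.u i (x j).1 (x j).2| ≤ ∑ j, |μ t j * G.u i (x j).1 (x j).2| :=
          Finset.abs_sum_le_sum_abs _ _
      _ ≤ ∑ j, μ t j * C := by
          refine Finset.sum_le_sum fun j _ => ?_
          rw [abs_mul, abs_of_nonneg (hμnn t j)]
          exact mul_le_mul_of_nonneg_left (hC _ _ _) (hμnn t j)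
      _ = C := by rw [← Finset.sum_mul, hμ1, one_mul]
  have hval : ∀ i t, pathValue δ (fun t => x (k t)) i t =
      ∑ j, μ t j * G.u i (x j).1 (x j).2 := fun i t =>
    discountedValue_eq_of_step hδ.1.le hδ.2 (fun _ => hC _ _ _) (hbound i)
      (fun t => hstep t fun j => G.u i (x j).1 (x j).2) t
  refine ⟨fun t => x (k t), fun i => by rw [hval, hμ0, hv_eq], fun i t => ?_⟩
  rw [hval, hv_eq]
  -- Adding `C` makes payoffs nonnegative, so a lower bound on the weights is enough.
  have h : ∑ j : ι, -(r * (2 * C)) ≤ ∑ j, (μ t j - l j) * (G.u i (x j).1 (x j).2 + C) := by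
    refine Finset.sum_le_sum fun j _ => ?_
    have h1 := abs_le.1 (hC i (x j).1 (x j).2)
    nlinarith [hμ t j]
  have h' : ∑ j, (μ t j - l j) * (G.u i (x j).1 (x j).2 + C) =
      ∑ j, μ t j * G.u i (x j).1 (x j).2 - ∑ j, l j * G.u i (x j).1 (x j).2 := by
    simp only [sub_mul, mul_add, Finset.sum_sub_distrib, Finset.sum_add_distrib,
      ← Finset.sum_mul, hμ1, hl1]
    ring
  rw [h', Finset.sum_const, Finset.card_univ, nsmul_eq_mul] at h
  linarith

/-! ### Simple strategy profiles and one-shot deviations. -/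

section SimpleStrategy

/-- User `i` is the only user whose action in `a` differs from that in `b`. -/
def UnilateralDeviation (a b : G.Profile) (i : Fin N) : Prop :=
  b i ≠ a i ∧ ∀ j, j ≠ i → b j = a j

lemma UnilateralDeviation.unique {a b : G.Profile} {i j : Fin N}
    (hi : UnilateralDeviation a b i) (hj : UnilateralDeviation a b j) : i = j := by
  by_contra h
  exact hi.1 (hj.2 i h)

/-- The state of a simple strategy profile is the path being followed (`none` is the path of the
equilibrium, `some i` the punishment of user `i`) and the current period on that path. A unilateral
deviation by user `i` starts the punishment of user `i`. -/
noncomputable def nextState (P : Option (Fin N) → ℕ → G.A₀ × G.Profile) (q : Option (Fin N) × ℕ)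
    (x : G.A₀ × G.Profile) : Option (Fin N) × ℕ :=
  open Classical in
  if h : ∃ i, UnilateralDeviation (P q.1 q.2).2 x.2 i then (some h.choose, 0) else (q.1, q.2 + 1)

/-- The state of a simple strategy profile after a history. -/
noncomputable def stateAfter (P : Option (Fin N) → ℕ → G.A₀ × G.Profile) (h : G.History) :
    Option (Fin N) × ℕ :=
  h.foldl (nextState P) (none, 0)

/-- The intervention rule of a simple strategy profile. -/
noncomputable def simpleRule (P : Option (Fin N) → ℕ → G.A₀ × G.Profile) : G.Rule :=
  fun h => (P (stateAfter P h).1 (stateAfter P h).2).1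

/-- The users' strategies in a simple strategy profile. -/
noncomputable def simpleStrategy (P : Option (Fin N) → ℕ → G.A₀ × G.Profile) : G.Strategy :=
  fun i h => (P (stateAfter P h).1 (stateAfter P h).2).2 i

variable {P : Option (Fin N) → ℕ → G.A₀ × G.Profile}

lemma nextState_of_deviation {q : Option (Fin N) × ℕ} {x : G.A₀ × G.Profile} {i : Fin N}
    (h : UnilateralDeviation (P q.1 q.2).2 x.2 i) : nextState P q x = (some i, 0) := by
  have hex : ∃ i, UnilateralDeviation (P q.1 q.2).2 x.2 i := ⟨i, h⟩
  rw [nextState, dif_pos hex, hex.choose_spec.unique h]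

lemma nextState_of_conform {q : Option (Fin N) × ℕ} {x : G.A₀ × G.Profile}
    (h : x.2 = (P q.1 q.2).2) : nextState P q x = (q.1, q.2 + 1) := by
  rw [nextState, dif_neg]
  rintro ⟨i, hi⟩
  exact hi.1 (by rw [h])

lemma stateAfter_append_singleton (h : G.History) (x : G.A₀ × G.Profile) :
    stateAfter P (h ++ [x]) = nextState P (stateAfter P h) x := by
  simp [stateAfter]

lemma payoff_eq_discountedValue (δ : ℝ) (σ₀ : G.Rule) (σ : G.Strategy) (i : Fin N) :
    payoff δ σ₀ σ i =
      discountedValue δ (fun t => G.u i (outcome σ₀ σ t).1 (outcome σ₀ σ t).2) 0 := by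
  simp [payoff, discountedValue]

variable {δ C : ℝ}

lemma pathValue_succ (h0 : 0 ≤ δ) (h1 : δ < 1) (hC : ∀ i a₀ a, |G.u i a₀ a| ≤ C)
    (s : ℕ → G.A₀ × G.Profile) (i : Fin N) (t : ℕ) :
    pathValue δ s i t = (1 - δ) * G.u i (s t).1 (s t).2 + δ * pathValue δ s i (t + 1) :=
  discountedValue_succ h0 h1 (fun _ => hC _ _ _) t

lemma abs_pathValue_le (h0 : 0 ≤ δ) (h1 : δ < 1) (hC : ∀ i a₀ a, |G.u i a₀ a| ≤ C)
    (s : ℕ → G.A₀ × G.Profile) (i : Fin N) (t : ℕ) : |pathValue δ s i t| ≤ C :=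
  abs_discountedValue_le h0 h1 (fun _ => hC _ _ _) t

/-- The payoff of a simple strategy profile after a history is the value of the rest of the
current path. -/
lemma payoff_simple_after (h0 : 0 ≤ δ) (h1 : δ < 1) (hC : ∀ i a₀ a, |G.u i a₀ a| ≤ C)
    (h : G.History) (i : Fin N) :
    payoff δ (Rule.after (simpleRule P) h) (Strategy.after (simpleStrategy P) h) i =
      pathValue δ (P (stateAfter P h).1) i (stateAfter P h).2 := by
  set σ₀ := Rule.after (simpleRule P) h
  set σ := Strategy.after (simpleStrategy P) h
  let q : ℕ → Option (Fin N) × ℕ := fun t => stateAfter P (h ++ inducedHistory σ₀ σ t)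
  have hout : ∀ t, outcome σ₀ σ t = P (q t).1 (q t).2 := fun t => rfl
  have hq : ∀ t, q (t + 1) = ((q t).1, (q t).2 + 1) := by
    intro t
    have : q (t + 1) = nextState P (q t) (outcome σ₀ σ t) := by
      simp only [q, inducedHistory, outcome]
      rw [← List.append_assoc, stateAfter_append_singleton]
    rw [this, nextState_of_conform (by rw [hout])]
  rw [payoff_eq_discountedValue]
  have := discountedValue_eq_of_step (x := fun t => G.u i (outcome σ₀ σ t).1 (outcome σ₀ σ t).2)
    (W := fun t => pathValue δ (P (q t).1) i (q t).2) h0 h1 (fun _ => hC _ _ _)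
    (fun t => abs_pathValue_le h0 h1 hC _ _ _)
    (fun t => by simp only [hq, hout]; exact pathValue_succ h0 h1 hC _ _ _) 0
  simpa [q, inducedHistory] using this

/-- A simple strategy profile is subgame perfect if no one-shot deviation from any of its paths,
followed by the punishment of the deviator, is profitable. -/
theorem isSubgamePerfect_simple (h0 : 0 ≤ δ) (h1 : δ < 1) (hC : ∀ i a₀ a, |G.u i a₀ a| ≤ C)
    (hdev : ∀ k t i (b : G.A i),
      (1 - δ) * G.u i (P k t).1 (Function.update (P k t).2 i b) +
        δ * pathValue δ (P (some i)) i 0 ≤ pathValue δ (P k) i t) :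
    IsSubgamePerfect δ (simpleRule P) (simpleStrategy P) := by
  intro h i τ
  rw [payoff_simple_after h0 h1 hC, payoff_eq_discountedValue]
  set σ₀ := Rule.after (simpleRule P) h
  set σ := Strategy.after (Function.update (simpleStrategy P) i τ) h
  let q : ℕ → Option (Fin N) × ℕ := fun t => stateAfter P (h ++ inducedHistory σ₀ σ t)
  have hout₀ : ∀ t, (outcome σ₀ σ t).1 = (P (q t).1 (q t).2).1 := fun t => rfl
  have hout : ∀ t, (outcome σ₀ σ t).2 =
      Function.update (P (q t).1 (q t).2).2 i (τ (h ++ inducedHistory σ₀ σ t)) := by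
    intro t
    funext j
    rcases eq_or_ne j i with rfl | hj
    · simp [outcome, play, σ, Strategy.after]
    · simp [outcome, play, σ, Strategy.after, hj, simpleStrategy, q]
  have hq : ∀ t, q (t + 1) = nextState P (q t) (outcome σ₀ σ t) := by
    intro t
    simp only [q, inducedHistory, outcome]
    rw [← List.append_assoc, stateAfter_append_singleton]
  -- The value of the rest of the current path obeys the recursion with equality when `i` conforms,
  -- and with inequality by `hdev` when `i` deviates; so an arbitrary `τ` is handled at once.
  have := discountedValue_le_of_step (x := fun t => G.u i (outcome σ₀ σ t).1 (outcome σ₀ σ t).2)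
    (W := fun t => pathValue δ (P (q t).1) i (q t).2) h0 h1 (fun _ => hC _ _ _)
    (fun t => abs_pathValue_le h0 h1 hC _ _ _) (fun t => by
      by_cases hτ : τ (h ++ inducedHistory σ₀ σ t) = (P (q t).1 (q t).2).2 i
      · have hc : (outcome σ₀ σ t).2 = (P (q t).1 (q t).2).2 := by
          rw [hout, hτ, Function.update_eq_self]
        simp only [hq, nextState_of_conform hc, hout₀]
        rw [hc]
        exact (pathValue_succ h0 h1 hC _ _ _).ge
      · have hd : UnilateralDeviation (P (q t).1 (q t).2).2 (outcome σ₀ σ t).2 i := by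
          rw [hout]
          refine ⟨by simpa using hτ, fun j hj => by simp [hj]⟩
        simp only [hq, nextState_of_deviation hd, hout₀]
        rw [hout]
        exact hdev _ _ _ _) 0
  simpa [q, inducedHistory] using this

end SimpleStrategy

/-! ### Punishment paths. -/

/-- The path on which `m` is played for `T` periods and the path `s` is followed afterwards. -/
def delayedPath (T : ℕ) (m : G.A₀ × G.Profile) (s : ℕ → G.A₀ × G.Profile) (t : ℕ) :
    G.A₀ × G.Profile :=
  if t < T then m else s (t - T)

section DelayedPath

variable {δ C : ℝ} {T : ℕ} {m : G.A₀ × G.Profile} {s : ℕ → G.A₀ × G.Profile}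

lemma pathValue_delayedPath_add (i : Fin N) (t : ℕ) :
    pathValue δ (delayedPath T m s) i (T + t) = pathValue δ s i t := by
  have h : ∀ n, delayedPath T m s (T + t + n) = s (t + n) := by
    intro n
    rw [delayedPath, if_neg (by omega), show T + t + n - T = t + n by omega]
  simp only [pathValue, discountedValue, h]

/-- Counting the periods that remain lets the induction run backwards from the start of `s`. -/
lemma pathValue_delayedPath_sub (h0 : 0 ≤ δ) (h1 : δ < 1) (hC : ∀ i a₀ a, |G.u i a₀ a| ≤ C)
    (i : Fin N) {n : ℕ} (hn : n ≤ T) :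
    pathValue δ (delayedPath T m s) i (T - n) =
      (1 - δ ^ n) * G.u i m.1 m.2 + δ ^ n * pathValue δ s i 0 := by
  induction n with
  | zero => simpa using pathValue_delayedPath_add (T := T) (m := m) (s := s) i 0
  | succ n ih =>
    have hm : delayedPath T m s (T - (n + 1)) = m := if_pos (by omega)
    rw [pathValue_succ h0 h1 hC, hm, show T - (n + 1) + 1 = T - n by omega, ih (by omega)]
    ring

end DelayedPath

/-- Against some action of the device and of the other users, user `i` is held below any level
above the minmax payoff. -/
lemma exists_punishment {C : ℝ} (hC : ∀ i a₀ a, |G.u i a₀ a| ≤ C) [Nonempty G.Profile]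
    {i : Fin N} {q : ℝ} (hq : G.minmax i < q) :
    ∃ (m : G.A₀ × G.Profile) (w : ℝ), w < q ∧
      ∀ b, G.u i m.1 (Function.update m.2 i b) ≤ w := by
  have : Nonempty G.A₀ := ⟨G.null⟩
  obtain ⟨m, hm⟩ := exists_lt_of_ciInf_lt hq
  refine ⟨m, _, hm, fun b => le_ciSup (f := fun b => G.u i m.1 (Function.update m.2 i b)) ?_ b⟩
  exact ⟨C, by rintro _ ⟨b, rfl⟩; exact (le_abs_self _).trans (hC _ _ _)⟩

lemma nonempty_profile_of_mem_feasible {v : Fin N → ℝ} (hv : v ∈ G.feasible) :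
    Nonempty G.Profile := by
  obtain ⟨_, _, a, _⟩ := convexHull_nonempty_iff.1 ⟨v, hv⟩
  exact ⟨a⟩

end InterventionGame

/-! ### The equilibrium. -/

open InterventionGame

theorem proposition2 {N : ℕ} (G : InterventionGame N) (hbdd : G.BoundedPayoffs)
    (v : Fin N → ℝ) (hv : v ∈ G.feasibleIR) (hp : G.AllowsPlayerSpecificPunishments v) :
    ∃ δ₀ : ℝ, 0 ≤ δ₀ ∧ δ₀ < 1 ∧ ∀ δ : ℝ, δ₀ < δ → δ < 1 →
      ∃ (σ₀ : G.Rule) (σ : G.Strategy),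
        InterventionGame.IsSubgamePerfect δ σ₀ σ ∧
          ∀ i, InterventionGame.payoff δ σ₀ σ i = v i := by
  suffices hev : ∀ᶠ δ : ℝ in 𝓝[<] 1, ∃ (σ₀ : G.Rule) (σ : G.Strategy),
      IsSubgamePerfect δ σ₀ σ ∧ ∀ i, payoff δ σ₀ σ i = v i by
    obtain ⟨l, hl, hsub⟩ := (mem_nhdsLT_iff_exists_Ioo_subset' (zero_lt_one' ℝ)).1 hev
    exact ⟨max l 0, le_max_right _ _, max_lt hl one_pos,
      fun δ h h1 => hsub ⟨(le_max_left _ _).trans_lt h, h1⟩⟩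
  obtain ⟨C, hC0, hC⟩ := hbdd.exists_uniform_bound
  obtain ⟨p, hpIR, hpv, hpp⟩ := hp
  have := nonempty_profile_of_mem_feasible hv.1
  choose m w hw hm using fun i => exists_punishment hC ((hpIR i).2 i)
  obtain ⟨c, hc, hcw, hcp⟩ : ∃ c : ℝ, 0 < c ∧ (∀ i, w i ≤ p i i - c) ∧
      ∀ i j, j ≠ i → p i i ≤ p j i - c := by
    obtain ⟨c₁, h₁, h₁'⟩ := exists_pos_forall_le fun i => sub_pos.2 (hw i)
    obtain ⟨c₂, h₂, h₂'⟩ := exists_pos_forall_le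
      fun x : {x : Fin N × Fin N // x.2 ≠ x.1} => sub_pos.2 (hpp x.1.1 x.1.2 x.2)
    exact ⟨min c₁ c₂, lt_min h₁ h₂, fun i => by linarith [h₁' i, min_le_left c₁ c₂],
      fun i j hj => by linarith [h₂' ⟨(i, j), hj⟩, min_le_right c₁ c₂]⟩
  -- Punishment periods will weigh at most `2κ` and payoffs differ by at most `2C`, so their total
  -- effect stays within the margin `c`.
  obtain ⟨κ, hκ, hκ1, hκC⟩ : ∃ κ : ℝ, 0 < κ ∧ κ ≤ 1 / 4 ∧ 4 * κ * C ≤ c := by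
    refine ⟨min (1 / 4) (c / (4 * C)), by positivity, min_le_left _ _, ?_⟩
    have h := (le_div_iff₀ (by positivity)).1 (min_le_right (1 / 4) (c / (4 * C)))
    linarith
  have hε : 0 < κ * c / 2 := by positivity
  filter_upwards [eventually_nhdsLT_one_pos, eventually_one_sub_le hκ,
    eventually_one_sub_le (show 0 < κ * c / (4 * C) by positivity),
    eventually_exists_path hC hv.1 hε,
    eventually_all.2 fun i => eventually_exists_path hC (hpIR i).1 hε]
    with δ ⟨h0, h1⟩ hδκ hδC ⟨s, hs0, hs⟩ hr
  choose r hr0 hr using hr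
  rw [le_div_iff₀ (by positivity)] at hδC
  obtain ⟨T, hT, hT'⟩ := exists_pow_mem_window h1 hκ (by linarith) hδκ
  let P : Option (Fin N) → ℕ → G.A₀ × G.Profile :=
    fun k => k.elim s fun i => delayedPath T (m i) (r i)
  have hg : ∀ i, G.u i (m i).1 (m i).2 ≤ w i := fun i => by
    simpa using hm i ((m i).2 i)
  have hub : ∀ i a₀ a, G.u i a₀ a ≤ C := fun i a₀ a => (abs_le.1 (hC i a₀ a)).2
  have hlb : ∀ i a₀ a, -C ≤ G.u i a₀ a := fun i a₀ a => (abs_le.1 (hC i a₀ a)).1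
  have hpC : ∀ i j, p i j ≤ C := fun i j => by
    rw [← hr0 i j]
    exact (abs_le.1 (abs_pathValue_le h0.le h1 hC _ _ _)).2
  have hU_eq : ∀ i, pathValue δ (P (some i)) i 0 =
      (1 - δ ^ T) * G.u i (m i).1 (m i).2 + δ ^ T * p i i := fun i => by
    have h := pathValue_delayedPath_sub (m := m i) (s := r i) h0.le h1 hC i le_rfl (T := T)
    rwa [Nat.sub_self, hr0] at h
  have hU : ∀ i, pathValue δ (P (some i)) i 0 ≤ p i i - κ * c := fun i => by
    rw [hU_eq]
    nlinarith [hg i, hcw i]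
  -- The immediate gain is at most `(1 - δ) * 2C ≤ κ * c / 2`, half of the punishment.
  have hcrude : ∀ i a₀ a, (1 - δ) * G.u i a₀ a + δ * pathValue δ (P (some i)) i 0 ≤
      p i i - κ * c / 2 := fun i a₀ a => by
    have hlow := (abs_le.1 (abs_pathValue_le h0.le h1 hC (P (some i)) i 0)).1
    nlinarith [hU i, hub i a₀ a]
  refine ⟨simpleRule P, simpleStrategy P, isSubgamePerfect_simple h0.le h1 hC ?_, fun i => ?_⟩
  · rintro (_ | j) t i b
    · refine (hcrude i _ _).trans ?_
      change _ ≤ pathValue δ s i t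
      linarith [hs i t, hpv i]
    · rcases lt_or_ge t T with ht | ht
      · obtain ⟨n, hn, rfl⟩ : ∃ n ≤ T, t = T - n := ⟨T - t, by omega, by omega⟩
        have hpow : δ ^ T ≤ δ ^ n := pow_le_pow_of_le_one h0.le h1.le hn
        have hpow1 : δ ^ n ≤ 1 := pow_le_one₀ h0.le h1.le
        have hval := pathValue_delayedPath_sub (m := m j) (s := r j) h0.le h1 hC i hn
        rw [hr0] at hval
        have hPm : P (some j) (T - n) = m j := if_pos ht
        change _ ≤ pathValue δ (delayedPath T (m j) (r j)) i (T - n)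
        rw [hval, hPm]
        rcases eq_or_ne j i with rfl | hj
        · rw [hU_eq]
          -- Measured from the payoff of `m j`, deviating is worth at most `(1 - δ) + δ` times the
          -- right side here, that is `δ ^ T` times the reward, while conforming gives `δ ^ n` times
          -- it.
          have hgap : w j - G.u j (m j).1 (m j).2 ≤
              δ ^ T * (p j j - G.u j (m j).1 (m j).2) := by
            nlinarith [hlb j (m j).1 (m j).2, hpC j j, hcw j, hg j]
          have hgain : (δ ^ T * (1 - δ)) * (p j j - G.u j (m j).1 (m j).2) ≤
              (δ ^ n - δ * δ ^ T) * (p j j - G.u j (m j).1 (m j).2) :=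
            mul_le_mul_of_nonneg_right (by linarith) (by linarith [hg j, hw j])
          nlinarith [mul_le_mul_of_nonneg_left (hm j b) (sub_nonneg.2 h1.le),
            mul_le_mul_of_nonneg_left hgap (sub_nonneg.2 h1.le)]
        · refine (hcrude i _ _).trans ?_
          have hloss : (1 - δ ^ n) * (p j i - G.u i (m j).1 (m j).2) ≤ 2 * κ * (2 * C) := by
            refine (mul_le_mul_of_nonneg_left (b := p j i - G.u i (m j).1 (m j).2) (c := 2 * C)
              ?_ (sub_nonneg.2 hpow1)).trans
              (mul_le_mul_of_nonneg_right ?_ (by positivity))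
            · linarith [hlb i (m j).1 (m j).2, hpC j i]
            · linarith
          linarith [hcp i j hj]
      · obtain ⟨n, rfl⟩ := Nat.exists_eq_add_of_le ht
        refine (hcrude i _ _).trans ?_
        change _ ≤ pathValue δ (delayedPath T (m j) (r j)) i (T + n)
        rw [pathValue_delayedPath_add]
        rcases eq_or_ne j i with rfl | hj
        · exact hr j j n
        · linarith [hr j i n, hpp i j hj]
  · have h := payoff_simple_after (P := P) h0.le h1 hC [] i
    exact h.trans (hs0 i)
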